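/- A tree is a connected acyclic simple graph (not necessarily countable or locally finite). An \emph{embedding} of a tree $T$ is an injective map $V(T)\to V(T)$ that preserves adjacency; $\mathrm{Emb}(T)$ denotes the monoid of all embeddings of $T$. A \emph{ray} is a one-way infinite path. Two rays of $T$ are equivalent if their intersection is a ray, and the equivalence classes are the \emph{ends} of $T$. An embedding $f$ \emph{preserves a ray} $R$ (forward) if $f(R)\subseteq R$, and it \emph{preserves an end} $\eta$ \emph{forward} if it preserves forward some ray $R\in\eta$. For a ray $R$ of $T$ and a vertex $r$ of $R$, let $T^R_r$ be the maximal subtree of $T$ that contains $r$ and is edge-disjoint from $R$, rooted at $r$. Two rooted trees are \emph{equimorphic} if each embeds in the other by an embedding that maps root to root. The ray $R$ is \emph{regular} if the rooted trees $T^R_r$ ($r\in R$) fall into only finitely many equimorphy classes; an end is \emph{regular} if it contains a regular ray. An embedding $f$ is \emph{elliptic} if $f(S)=S$ for some non-empty finite subtree $S$ of $T$, and \emph{non-elliptic} otherwise. Corollary. Let $T$ be a tree, and suppose that some regular end of $T$ is preserved forward by every embedding of $T$. Suppose moreover that at least one of the following holds: (a) there is a vertex $v$ of $T$ with $f(v)=v$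 for all $f\in\mathrm{Emb}(T)$; (b) there is an edge $\{x,y\}$ of $T$ with $\{f(x),f(y)\}=\{x,y\}$ for all $f\in\mathrm{Emb}(T)$; (c) $T$ has a non-elliptic embedding. Then there is a ray $R$ of $T$ with $f(R)\subseteq R$ for every $f\in\mathrm{Emb}(T)$. -/

import Mathlib

namespace TreeEnds

universe u

variable {V : Type u}

/-- An embedding of `T`: an injective self-map of the vertex set that preserves adjacency. -/
abbrev Emb (T : SimpleGraph V) : Type u := SimpleGraph.Copy T T

/-- A ray (one-way infinite path) of `T`, given by its vertices listed from its first vertex. -/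
structure Ray (T : SimpleGraph V) where
  vertex : ℕ → V
  injective : Function.Injective vertex
  adj : ∀ n, T.Adj (vertex n) (vertex (n + 1))

namespace Ray

variable {T : SimpleGraph V}

/-- The vertex set of a ray. -/
def verts (R : Ray T) : Set V := Set.range R.vertex

/-- The edge set of a ray. -/
def edges (R : Ray T) : Set (Sym2 V) := Set.range fun n => s(R.vertex n, R.vertex (n + 1))

/-- Two rays of a tree are equivalent if their intersection is a ray. (In a tree a ray is
determined, as a subgraph, by its vertex set.) -/
def Equivalent (R S : Ray T) : Prop := ∃ Q : Ray T, Q.verts = R.verts ∩ S.verts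

/-- The graph obtained from `T` by removing the edges of the ray `R`. -/
def offRay (R : Ray T) : SimpleGraph V := T.deleteEdges R.edges

/-- The vertices of the maximal subtree of `T` that contains `r` and is edge-disjoint from `R`. -/
def hangingSet (R : Ray T) (r : V) : Set V := {v | R.offRay.Reachable r v}

/-- The maximal subtree of `T` that contains `r` and is edge-disjoint from `R`. -/
def hangingTree (R : Ray T) (r : V) : SimpleGraph (R.hangingSet r) :=
  R.offRay.induce (R.hangingSet r)

/-- The vertex `r`, as the root of the tree hanging at `r`. -/
def hangingRoot (R : Ray T) (r : V) : R.hangingSet r := ⟨r, SimpleGraph.Reachable.refl r⟩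

end Ray

/-- There is an embedding of `G` into `H` that maps the root `a` to the root `b`. -/
def RootedEmbeds {A B : Type u} (G : SimpleGraph A) (a : A) (H : SimpleGraph B) (b : B) : Prop :=
  ∃ f : SimpleGraph.Copy G H, f a = b

/-- Equimorphy of rooted graphs: each embeds into the other by a root-preserving embedding. -/
def RootedEquimorphic {A B : Type u} (G : SimpleGraph A) (a : A) (H : SimpleGraph B) (b : B) :
    Prop :=
  RootedEmbeds G a H b ∧ RootedEmbeds H b G a

variable {T : SimpleGraph V}

/-- A ray is regular if the trees hanging at its vertices, each rooted at that vertex, fall into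
finitely many equimorphy classes. -/
def Ray.IsRegular (R : Ray T) : Prop :=
  ∃ F : Finset ℕ, ∀ n : ℕ, ∃ m ∈ F,
    RootedEquimorphic
      (R.hangingTree (R.vertex n)) (R.hangingRoot (R.vertex n))
      (R.hangingTree (R.vertex m)) (R.hangingRoot (R.vertex m))

/-- An end is an equivalence class of rays. -/
def IsEnd (η : Set (Ray T)) : Prop := ∃ R : Ray T, η = {S | R.Equivalent S}

/-- An end is regular if it contains a regular ray. -/
def IsRegularEnd (η : Set (Ray T)) : Prop := IsEnd η ∧ ∃ R ∈ η, R.IsRegular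

namespace Emb

/-- `f` preserves the ray `R` forward: `f(R) ⊆ R`. -/
def PreservesRay (f : Emb T) (R : Ray T) : Prop := f '' R.verts ⊆ R.verts

/-- `f` preserves the end `η` forward: it preserves forward some ray that belongs to `η`. -/
def PreservesEndForward (f : Emb T) (η : Set (Ray T)) : Prop := ∃ R ∈ η, PreservesRay f R

/-- `f` is elliptic: it fixes (setwise) a non-empty finite subtree. -/
def IsElliptic (f : Emb T) : Prop :=
  ∃ S : Set V, S.Finite ∧ S.Nonempty ∧ (T.induce S).Connected ∧ f '' S = S

end Emb

end TreeEnds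

open Set Function

namespace TreeEnds

universe u

/-! Orient every edge towards the preserved end. A ray meeting an upward ray infinitely often must
itself go upward, so every embedding commutes with the step `up` and shifts a tail of the ray by a
constant. A fixed vertex then fixes pointwise the ray leading from it to the end, and a fixed edge
has fixed endpoints, since a swap would contradict levels.

A non-elliptic embedding shifts a tail by some `d > 0`, and regularity makes the hanging trees
eventually `d`-periodic up to equimorphy. Cones are compared by the quasi-order `Le`. No late cone
of the ray embeds in one lying a positive multiple of `d` earlier (`not_ray_le_ray`): the map would
extend to an embedding shifting the ray backward. Hence no Hilbert hotel can absorb the ray child of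
a late ray vertex among the off-ray children (`no_hotel`).

If no tail were preserved by all embeddings, embeddings would leave the ray arbitrarily late. By the
hotel argument each departure produces an off-ray child sandwiched between two ray cones, and these
children can all be moved to one fixed ray vertex. There they form an infinite increasing chain,
which is a hotel. -/

/-- A forest directed towards the end of a distinguished ray: `up` moves every vertex one
step towards the end. -/
structure Ascent (V : Type u) where
  up : V → V
  level : V → ℤ
  level_up : ∀ v, level (up v) = level v + 1
  ray : ℕ → V
  up_ray : ∀ n, up (ray n) = ray (n + 1)
  exists_iterate : ∀ v, ∃ k m, up^[k] v = ray m

/-! ### Levels and cones. -/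

namespace Ascent

variable {V : Type u} (A : Ascent V)

lemma level_iterate (k : ℕ) (v : V) : A.level (A.up^[k] v) = A.level v + k := by
  induction k with
  | zero => simp
  | succ k ih => rw [iterate_succ_apply', A.level_up, ih]; push_cast; ring

lemma iterate_ray (k n : ℕ) : A.up^[k] (A.ray n) = A.ray (n + k) := by
  induction k with
  | zero => rfl
  | succ k ih => rw [iterate_succ_apply', ih, A.up_ray]; rfl

lemma level_ray (n : ℕ) : A.level (A.ray n) = A.level (A.ray 0) + n := by
  rw [← A.level_iterate, A.iterate_ray, zero_add]

lemma ray_injective : Injective A.ray := fun m n h => by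
  have := congrArg A.level h
  rw [A.level_ray, A.level_ray n] at this
  omega

lemma ray_inj {m n : ℕ} : A.ray m = A.ray n ↔ m = n := A.ray_injective.eq_iff

lemma exists_iterate_ge (v : V) (p : ℕ) : ∃ k m, p ≤ m ∧ A.up^[k] v = A.ray m := by
  obtain ⟨k, m, h⟩ := A.exists_iterate v
  refine ⟨p + k, m + p, by omega, ?_⟩
  rw [iterate_add_apply, h, iterate_ray]

/-- The cone of all vertices below `x`. -/
def below (x : V) : Set V := {v | ∃ k, A.up^[k] v = x}

lemma mem_below_self (x : V) : x ∈ A.below x := ⟨0, rfl⟩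

lemma mem_below_of_up {v x : V} (h : A.up v ∈ A.below x) : v ∈ A.below x := by
  obtain ⟨k, h⟩ := h
  exact ⟨k + 1, h⟩

lemma below_trans {v x y : V} (h : v ∈ A.below x) (h' : x ∈ A.below y) : v ∈ A.below y := by
  obtain ⟨k, rfl⟩ := h
  obtain ⟨l, rfl⟩ := h'
  exact ⟨l + k, iterate_add_apply _ _ _ _⟩

lemma level_le_of_mem_below {v x : V} (h : v ∈ A.below x) : A.level v ≤ A.level x := by
  obtain ⟨k, rfl⟩ := h
  rw [A.level_iterate]; omega

lemma up_not_mem_below (x : V) : A.up x ∉ A.below x := fun h => by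
  have := A.level_le_of_mem_below h
  rw [A.level_up] at this; omega

lemma up_mem_below {v x : V} (h : v ∈ A.below x) (hne : v ≠ x) : A.up v ∈ A.below x := by
  obtain ⟨k, h⟩ := h
  cases k with
  | zero => exact absurd h hne
  | succ k => exact ⟨k, h⟩

/-- Both `c` and `c'` lie on the upward path from `v`. If one came strictly first, its `up`, which
is in `S`, would lie in the cone of the other, which avoids `S`. -/
lemma eq_of_up_mem_of_mem_below {S : Set V} {c c' v : V} (hc : A.up c ∈ S) (hc' : A.up c' ∈ S)
    (hd : ∀ w ∈ A.below c, w ∉ S) (hd' : ∀ w ∈ A.below c', w ∉ S)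
    (h : v ∈ A.below c) (h' : v ∈ A.below c') : c = c' := by
  obtain ⟨k, rfl⟩ := h
  obtain ⟨l, rfl⟩ := h'
  rcases lt_trichotomy k l with hkl | rfl | hkl
  · refine absurd hc (hd' _ ⟨l - k - 1, ?_⟩)
    rw [← iterate_succ_apply, ← iterate_add_apply]; congr 1; omega
  · rfl
  · refine absurd hc' (hd _ ⟨k - l - 1, ?_⟩)
    rw [← iterate_succ_apply, ← iterate_add_apply]; congr 1; omega

/-! ### Partial embeddings and gluing. -/

/-- `g` is injective on `W` and commutes with `up` inside `W`. -/
def GoodOn (g : V → V) (W : Set V) : Prop :=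
  InjOn g W ∧ ∀ v ∈ W, A.up v ∈ W → g (A.up v) = A.up (g v)

/-- The cone below `x` embeds in the cone below `y`, by a map that sends `x` to `y`. -/
def Le (x y : V) : Prop := ∃ g, A.GoodOn g (A.below x) ∧ g x = y

variable {A}

lemma GoodOn.mono {g : V → V} {W W' : Set V} (h : A.GoodOn g W) (hW : W' ⊆ W) : A.GoodOn g W' :=
  ⟨h.1.mono hW, fun v hv hv' => h.2 v (hW hv) (hW hv')⟩

lemma GoodOn.iterate {g : V → V} {x v : V} (h : A.GoodOn g (A.below x)) {k : ℕ}
    (hk : A.up^[k] v = x) : A.up^[k] (g v) = g x := by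
  induction k generalizing v with
  | zero => exact congrArg g hk
  | succ k ih =>
    rw [iterate_succ_apply] at hk ⊢
    rw [← h.2 v ⟨k + 1, hk⟩ ⟨k, hk⟩, ih hk]

lemma GoodOn.mem_below {g : V → V} {x v : V} (h : A.GoodOn g (A.below x)) (hv : v ∈ A.below x) :
    g v ∈ A.below (g x) := by
  obtain ⟨k, hk⟩ := hv
  exact ⟨k, h.iterate hk⟩

lemma GoodOn.le {g : V → V} {x v : V} (h : A.GoodOn g (A.below x)) (hv : v ∈ A.below x) :
    A.Le v (g v) := ⟨g, h.mono fun _ hw => A.below_trans hw hv, rfl⟩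

lemma Le.refl (x : V) : A.Le x x := ⟨id, ⟨injOn_id _, fun _ _ _ => rfl⟩, rfl⟩

lemma Le.trans {x y z : V} (h : A.Le x y) (h' : A.Le y z) : A.Le x z := by
  obtain ⟨g, hg, rfl⟩ := h
  obtain ⟨g', hg', rfl⟩ := h'
  refine ⟨g' ∘ g, ⟨hg'.1.comp hg.1 fun v hv => hg.mem_below hv, fun v hv hv' => ?_⟩, rfl⟩
  have h1 := hg.mem_below hv'
  have h2 := hg.2 v hv hv'
  rw [comp_apply, comp_apply, h2, hg'.2 _ (hg.mem_below hv) (h2 ▸ h1)]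

/-- A map that is good on `S` extends over the cones hanging below `S`. -/
lemma exists_goodOn_extension {S C : Set V} {β γ : V → V} (hβ : A.GoodOn β S)
    (hCS : ∀ c ∈ C, A.up c ∈ S) (hC : ∀ c ∈ C, ∀ w ∈ A.below c, w ∉ S)
    (hγ : InjOn γ C) (hle : ∀ c ∈ C, A.Le c (γ c)) (hup : ∀ c ∈ C, A.up (γ c) = β (A.up c))
    (hγS : ∀ c ∈ C, ∀ w ∈ A.below (γ c), w ∉ β '' S) :
    ∃ g, A.GoodOn g (S ∪ {v | ∃ c ∈ C, v ∈ A.below c}) ∧ EqOn g β S := by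
  classical
  choose! G hG hGc using hle
  choose! top htop hvtop using fun v (h : ∃ c ∈ C, v ∈ A.below c) => h
  have top_eq : ∀ {v c}, c ∈ C → v ∈ A.below c → top v = c := fun {v c} hc hv =>
    A.eq_of_up_mem_of_mem_below (hCS _ (htop v ⟨c, hc, hv⟩)) (hCS c hc)
      (hC _ (htop v ⟨c, hc, hv⟩)) (hC c hc) (hvtop v ⟨c, hc, hv⟩) hv
  set g : V → V := fun v => if v ∈ S then β v else G (top v) v with hg
  have gS : ∀ {v}, v ∈ S → g v = β v := fun hv => if_pos hv
  have gC : ∀ {v c}, c ∈ C → v ∈ A.below c → g v = G c v := fun {v c} hc hv => by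
    rw [hg]; simp only [if_neg (hC c hc v hv), top_eq hc hv]
  have gmem : ∀ {v c}, c ∈ C → v ∈ A.below c → g v ∈ A.below (γ c) := fun {v c} hc hv => by
    rw [gC hc hv, ← hGc c hc]; exact (hG c hc).mem_below hv
  refine ⟨g, ⟨?_, ?_⟩, fun v hv => gS hv⟩
  · rintro v (hv | ⟨c, hc, hv⟩) w (hw | ⟨c', hc', hw⟩) h
    · rw [gS hv, gS hw] at h
      exact hβ.1 hv hw h
    · refine absurd ⟨v, hv, ?_⟩ (hγS c' hc' _ (gmem hc' hw))
      rw [← h, gS hv]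
    · refine absurd ⟨w, hw, ?_⟩ (hγS c hc _ (gmem hc hv))
      rw [h, gS hw]
    · have hcc : c = c' := hγ hc hc' <| A.eq_of_up_mem_of_mem_below (S := β '' S)
        ⟨_, hCS c hc, (hup c hc).symm⟩ ⟨_, hCS c' hc', (hup c' hc').symm⟩ (hγS c hc) (hγS c' hc')
        (gmem hc hv) (h ▸ gmem hc' hw)
      subst hcc
      rw [gC hc hv, gC hc hw] at h
      exact (hG c hc).1 hv hw h
  · rintro v hv (hv' | ⟨c, hc, hv'⟩)
    · rcases hv with hv | ⟨c, hc, hv⟩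
      · rw [gS hv, gS hv', hβ.2 v hv hv']
      · obtain rfl : v = c := by
          by_contra hne
          exact hC c hc _ (A.up_mem_below hv hne) hv'
        rw [gS hv', gC hc hv, hGc v hc, hup v hc]
    · have hvc := A.mem_below_of_up hv'
      rw [gC hc hvc, gC hc hv', (hG c hc).2 v hvc hv']

/-- Gluing with `S = {x}`: the cone below `x` is `x` together with the cones of its children. -/
lemma le_of_children {x y : V} {φ : V → V} (hφ : InjOn φ (A.up ⁻¹' {x}))
    (hm : MapsTo φ (A.up ⁻¹' {x}) (A.up ⁻¹' {y})) (hle : ∀ c, A.up c = x → A.Le c (φ c)) :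
    A.Le x y := by
  have key : ∀ c z, A.up c = z → ∀ w ∈ A.below c, w ≠ z := by
    rintro c z rfl w hw rfl
    exact A.up_not_mem_below c hw
  obtain ⟨g, hg, hgx⟩ := exists_goodOn_extension (A := A) (S := {x}) (C := A.up ⁻¹' {x})
    (β := fun _ => y) (γ := φ)
    ⟨injOn_singleton _ _, fun v hv hv' => by
      rw [mem_singleton_iff] at hv hv'
      have := A.level_up v
      rw [hv', hv] at this; omega⟩
    (fun c hc => hc) (fun c hc w hw => key c x hc w hw) hφ hle (fun c hc => hm hc)
    (fun c hc w hw => by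
      rw [image_singleton]; exact key _ y (hm hc) w hw)
  refine ⟨g, hg.mono ?_, hgx rfl⟩
  rintro v ⟨k, hk⟩
  cases k with
  | zero => exact Or.inl hk
  | succ k => exact Or.inr ⟨A.up^[k] v, by rw [iterate_succ_apply'] at hk; exact hk, k, rfl⟩

/-! ### Hanging trees and embeddings. -/

variable (A)

/-- The children of the `n`-th vertex of the ray that are not on the ray. -/
def side (n : ℕ) : Set V := {c | A.up c = A.ray n ∧ ∀ i, c ≠ A.ray i}

/-- The tree hanging at the `n`-th vertex of the ray embeds in the one hanging at the `m`-th. -/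
def SideLe (n m : ℕ) : Prop :=
  ∃ φ : V → V, InjOn φ (A.side n) ∧ MapsTo φ (A.side n) (A.side m) ∧ ∀ c ∈ A.side n, A.Le c (φ c)

variable {A}

lemma SideLe.refl (n : ℕ) : A.SideLe n n := ⟨id, injOn_id _, mapsTo_id _, fun _ _ => Le.refl _⟩

lemma SideLe.trans {n m l : ℕ} (h : A.SideLe n m) (h' : A.SideLe m l) : A.SideLe n l := by
  obtain ⟨φ, h1, h2, h3⟩ := h
  obtain ⟨ψ, h4, h5, h6⟩ := h'
  exact ⟨ψ ∘ φ, h4.comp h1 h2, h5.comp h2, fun c hc => (h3 c hc).trans (h6 _ (h2 hc))⟩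

lemma mem_side_or_eq {n : ℕ} {c : V} (h : A.up c = A.ray (n + 1)) :
    c ∈ A.side (n + 1) ∨ c = A.ray n := by
  by_cases hc : ∃ i, c = A.ray i
  · obtain ⟨i, rfl⟩ := hc
    rw [A.up_ray, A.ray_inj] at h
    right; congr 1; omega
  · exact Or.inl ⟨h, not_exists.1 hc⟩

variable (A) in
/-- The embeddings of the tree, as self-maps commuting with `up`. -/
structure IsEmb (f : V → V) : Prop where
  inj : Injective f
  comm : ∀ v, f (A.up v) = A.up (f v)

lemma IsEmb.goodOn {f : V → V} (h : A.IsEmb f) (W : Set V) : A.GoodOn f W :=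
  ⟨h.inj.injOn, fun v _ _ => h.comm v⟩

lemma IsEmb.le {f : V → V} (h : A.IsEmb f) (v : V) : A.Le v (f v) := ⟨f, h.goodOn _, rfl⟩

lemma IsEmb.comp {f g : V → V} (hf : A.IsEmb f) (hg : A.IsEmb g) : A.IsEmb (f ∘ g) :=
  ⟨hf.inj.comp hg.inj, fun v => by simp [hg.comm, hf.comm]⟩

lemma IsEmb.iterate {f : V → V} (hf : A.IsEmb f) (k : ℕ) : A.IsEmb (f^[k]) := by
  induction k with
  | zero => exact ⟨injective_id, fun _ => rfl⟩
  | succ k ih => exact ih.comp hf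

lemma IsEmb.up_iterate {f : V → V} (hf : A.IsEmb f) (k : ℕ) (v : V) :
    f (A.up^[k] v) = A.up^[k] (f v) := by
  induction k with
  | zero => rfl
  | succ k ih => rw [iterate_succ_apply', iterate_succ_apply', hf.comm, ih]

lemma IsEmb.ray_add {f : V → V} (hf : A.IsEmb f) {n m : ℕ} (h : f (A.ray n) = A.ray m) (k : ℕ) :
    f (A.ray (n + k)) = A.ray (m + k) := by
  rw [← A.iterate_ray, hf.up_iterate, h, A.iterate_ray]

lemma IsEmb.iterate_ray_shift {f : V → V} {n e : ℕ} (h : ∀ i, n ≤ i → f (A.ray i) = A.ray (i + e))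
    (k : ℕ) {i : ℕ} (hi : n ≤ i) : f^[k] (A.ray i) = A.ray (i + e * k) := by
  induction k with
  | zero => rfl
  | succ k ih => rw [iterate_succ_apply', ih, h _ (by omega)]; congr 1; ring

/-- The hypothesis sits one index below the conclusion: a side child of `ray (n + 1)` sent onto the
ray would have the same image as `ray n`, against injectivity. -/
lemma IsEmb.sideLe {f : V → V} (hf : A.IsEmb f) {n e : ℕ} (h : f (A.ray n) = A.ray (n + e)) :
    A.SideLe (n + 1) (n + 1 + e) := by
  have h' : f (A.ray (n + 1)) = A.ray (n + 1 + e) := by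
    rw [hf.ray_add h]; congr 1; omega
  refine ⟨f, hf.inj.injOn, fun c hc => ⟨by rw [← hf.comm, hc.1, h'], fun i hi => ?_⟩,
    fun c _ => hf.le c⟩
  have h1 := hf.comm c
  rw [hc.1, h', hi, A.up_ray, A.ray_inj] at h1
  refine hc.2 n (hf.inj ?_)
  rw [hi, h]; congr 1; omega

/-! ### The periodic case. -/

variable (A) in
/-- Every embedding pushes the ray forward, some embedding shifts its tail by `d`, and from `N` on
the hanging trees are `d`-periodic up to equimorphy. -/
structure Periodic (d N : ℕ) : Prop where
  pos : 0 < d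
  shift : ∀ f, A.IsEmb f → ∃ c n₀, ∀ n, n₀ ≤ n → f (A.ray n) = A.ray (n + c)
  translate : ∃ f, A.IsEmb f ∧ ∀ n, N ≤ n → f (A.ray n) = A.ray (n + d)
  sideLe : ∀ n, N ≤ n → A.SideLe (n + d) n

namespace Periodic

variable {d N : ℕ}

lemma sideLe_mul (h : A.Periodic d N) {n : ℕ} (hn : N ≤ n) (k : ℕ) : A.SideLe (n + d * k) n := by
  induction k with
  | zero => exact SideLe.refl _
  | succ k ih =>
    rw [Nat.mul_succ, ← add_assoc]
    exact (h.sideLe (n + d * k) (by omega)).trans ih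

lemma translate_mul (h : A.Periodic d N) (k : ℕ) :
    ∃ f, A.IsEmb f ∧ ∀ n, N ≤ n → f (A.ray n) = A.ray (n + d * k) := by
  obtain ⟨f, hf, hs⟩ := h.translate
  exact ⟨f^[k], hf.iterate k, fun n hn => IsEmb.iterate_ray_shift hs k hn⟩

lemma sideLe_add_mul (h : A.Periodic d N) {n : ℕ} (hn : N ≤ n) (k : ℕ) :
    A.SideLe (n + 1) (n + 1 + d * k) := by
  obtain ⟨f, hf, hs⟩ := h.translate_mul k
  exact hf.sideLe (hs n hn)

lemma ray_le_ray (h : A.Periodic d N) {n : ℕ} (hn : N ≤ n) (k : ℕ) :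
    A.Le (A.ray n) (A.ray (n + d * k)) := by
  obtain ⟨f, hf, hs⟩ := h.translate_mul k
  exact hs n hn ▸ hf.le _

/-- Such a map, glued to the backward shift of the later ray and to embeddings of the later hanging
trees, would be an embedding of the whole tree moving the ray backward. -/
lemma not_ray_le_ray (h : A.Periodic d N) {q k : ℕ} (hq : N ≤ q) (hk : 0 < k) :
    ¬ A.Le (A.ray (q + d * k)) (A.ray q) := by
  classical
  rintro ⟨g₀, hg₀, hgr⟩
  set s := d * k with hs
  have hspos : 0 < s := Nat.mul_pos h.pos hk
  have hside : ∀ i, ∃ φ : V → V, InjOn φ (A.side (q + i + s)) ∧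
      MapsTo φ (A.side (q + i + s)) (A.side (q + i)) ∧
      ∀ c ∈ A.side (q + i + s), A.Le c (φ c) := fun i => h.sideLe_mul (by omega) k
  choose φ hφi hφm hφl using hside
  -- `S` is the tail to be shifted back by `β`, and `C` consists of the tops of the cones hanging
  -- from it. `γ` follows `g₀` below the first vertex of the tail, where the previous ray vertex is
  -- also a child, and periodicity elsewhere.
  set S : Set V := A.ray '' {i | q + s ≤ i} with hS
  set C : Set V := {c | A.up c ∈ S ∧ c ∉ S} with hC
  set idx : V → ℕ := invFun A.ray with hidx
  have idx_ray : ∀ n, idx (A.ray n) = n := leftInverse_invFun A.ray_injective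
  set β : V → V := fun v => A.ray (idx v - s) with hβ
  set γ : V → V := fun c => if A.up c = A.ray (q + s) then g₀ c else φ (idx (A.up c) - s - q) c
    with hγ
  have Cside : ∀ c ∈ C, ∀ i, 0 < i → A.up c = A.ray (q + i + s) → c ∈ A.side (q + i + s) := by
    intro c hc i hi hci
    refine ⟨hci, fun j hj => hc.2 ⟨j, ?_, hj.symm⟩⟩
    rw [hj, A.up_ray, A.ray_inj] at hci
    show q + s ≤ j
    omega
  have γcase : ∀ c ∈ C, (A.up c = A.ray (q + s) ∧ γ c = g₀ c) ∨
      ∃ i, 0 < i ∧ A.up c = A.ray (q + i + s) ∧ c ∈ A.side (q + i + s) ∧ γ c = φ i c := by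
    intro c hc
    obtain ⟨j, hj, hjc⟩ := hc.1
    have hj : q + s ≤ j := hj
    rcases hj.eq_or_lt with rfl | hlt
    · exact Or.inl ⟨hjc.symm, if_pos hjc.symm⟩
    · have e : A.up c = A.ray (q + (j - s - q) + s) := by rw [← hjc]; congr 1; omega
      refine Or.inr ⟨j - s - q, by omega, e, Cside c hc _ (by omega) e, ?_⟩
      have hne : A.up c ≠ A.ray (q + s) := by
        rw [← hjc]; exact fun h => hlt.ne' (A.ray_injective h)
      rw [hγ]; simp only [if_neg hne]
      rw [← hjc, idx_ray]
  have memb : ∀ c, A.up c = A.ray (q + s) → c ∈ A.below (A.ray (q + s)) := fun c hc => ⟨1, hc⟩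
  have γup : ∀ c ∈ C, A.up (γ c) = β (A.up c) := by
    intro c hc
    rcases γcase c hc with ⟨h1, h2⟩ | ⟨i, hi, h1, h2, h3⟩
    · rw [h2, ← hg₀.2 c (memb c h1) (h1 ▸ A.mem_below_self _), h1, hgr, hβ]
      simp only [idx_ray, Nat.add_sub_cancel]
    · rw [h3, (hφm i h2).1, h1, hβ]
      simp only [idx_ray, Nat.add_sub_cancel]
  have γS : ∀ c ∈ C, ∀ w ∈ A.below (γ c), w ∉ β '' S := by
    rintro c hc w hw ⟨_, ⟨j, hj, rfl⟩, rfl⟩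
    have hj : q + s ≤ j := hj
    obtain ⟨l, hl⟩ := hw
    rw [hβ] at hl
    simp only [idx_ray] at hl
    rw [A.iterate_ray] at hl
    rcases γcase c hc with ⟨h1, h2⟩ | ⟨i, hi, h1, h2, h3⟩
    · have := γup c hc
      rw [h1, ← hl, A.up_ray, hβ] at this
      simp only [idx_ray] at this
      rw [A.ray_inj] at this
      omega
    · exact (hφm i h2).2 _ (h3 ▸ hl.symm)
  obtain ⟨g, hg, hgβ⟩ := exists_goodOn_extension (A := A) (S := S) (C := C) (β := β) (γ := γ)
    ⟨by
      rintro _ ⟨i, hi, rfl⟩ _ ⟨j, hj, rfl⟩ hij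
      have hi : q + s ≤ i := hi
      have hj : q + s ≤ j := hj
      rw [hβ] at hij
      simp only [idx_ray, A.ray_inj] at hij
      rw [A.ray_inj]; omega,
    by
      rintro _ ⟨i, hi, rfl⟩ -
      have hi : q + s ≤ i := hi
      rw [A.up_ray, hβ]
      simp only [idx_ray]
      rw [A.up_ray]; congr 1; omega⟩
    (fun c hc => hc.1)
    (by
      rintro c hc w ⟨l, hl⟩ ⟨i, hi, rfl⟩
      have hi : q + s ≤ i := hi
      rw [A.iterate_ray] at hl
      exact hc.2 ⟨i + l, show q + s ≤ i + l by omega, hl⟩)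
    (by
      intro c hc c' hc' hcc
      have hβinj : A.up c = A.up c' := by
        obtain ⟨i, hi, hic⟩ := hc.1
        obtain ⟨j, hj, hjc⟩ := hc'.1
        have hi : q + s ≤ i := hi
        have hj : q + s ≤ j := hj
        have h1 := γup c hc
        rw [hcc, γup c' hc', ← hic, ← hjc, hβ] at h1
        simp only [idx_ray, A.ray_inj] at h1
        rw [← hic, ← hjc, A.ray_inj]; omega
      rcases γcase c hc with ⟨h1, h2⟩ | ⟨i, hi, h1, h2, h3⟩ <;>
        rcases γcase c' hc' with ⟨h1', h2'⟩ | ⟨i', hi', h1', h2', h3'⟩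
      · rw [h2, h2'] at hcc
        exact hg₀.1 (memb c h1) (memb c' h1') hcc
      · rw [h1, h1', A.ray_inj] at hβinj; omega
      · rw [h1, h1', A.ray_inj] at hβinj; omega
      · rw [h1, h1', A.ray_inj] at hβinj
        obtain rfl : i = i' := by omega
        rw [h3, h3'] at hcc
        exact hφi i h2 h2' hcc)
    (by
      intro c hc
      rcases γcase c hc with ⟨h1, h2⟩ | ⟨i, hi, h1, h2, h3⟩
      · rw [h2]; exact hg₀.le (memb c h1)
      · rw [h3]; exact hφl i c h2)
    γup γS
  -- Climbing from `v`, the last vertex before the first entry into `S` belongs to `C`.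
  have huniv : S ∪ {v | ∃ c ∈ C, v ∈ A.below c} = univ := by
    refine eq_univ_of_forall fun v => ?_
    have hex : ∃ k, A.up^[k] v ∈ S := by
      obtain ⟨k, m, hm, hkm⟩ := A.exists_iterate_ge v (q + s)
      exact ⟨k, m, hm, hkm.symm⟩
    rcases hk : Nat.find hex with _ | k
    · have := Nat.find_spec hex
      rw [hk] at this
      exact Or.inl this
    · have h1 := Nat.find_spec hex
      rw [hk, iterate_succ_apply'] at h1
      exact Or.inr ⟨A.up^[k] v, ⟨h1, Nat.find_min hex (by omega)⟩, k, rfl⟩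
  rw [huniv] at hg
  -- The shift `c` is a natural number, whereas `g` moves the tail by `-s`.
  obtain ⟨c, n₀, hc⟩ := h.shift g
    ⟨injOn_univ.1 hg.1, fun v => hg.2 v (mem_univ _) (mem_univ _)⟩
  have h1 := hc (n₀ + (q + s)) (by omega)
  rw [hgβ ⟨_, show q + s ≤ _ by omega, rfl⟩, hβ] at h1
  simp only [idx_ray, A.ray_inj] at h1
  omega

/-- No set of children of a late ray vertex, containing the child on the ray, can be pushed
injectively and increasingly into itself off the ray. -/
lemma no_hotel (h : A.Periodic d N) {n : ℕ} (hn : N + d ≤ n) {P : Set V} {Φ : V → V}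
    (hrP : A.ray n ∈ P) (hi : InjOn Φ P)
    (hm : MapsTo Φ P (P ∩ A.side (n + 1))) (hle : ∀ c ∈ P, A.Le c (Φ c)) : False := by
  classical
  -- The margin `d` in `hn` leaves room to compare with the hanging tree one period earlier.
  obtain ⟨q, rfl⟩ : ∃ q, n = q + d := ⟨n - d, by omega⟩
  obtain ⟨η, hη, hηm, hηl⟩ := h.sideLe (q + 1) (by omega)
  rw [show q + 1 + d = q + d + 1 by omega] at hη hηm hηl
  -- Extended by the identity, `Φ` pushes all children of `ray (n + 1)` off the ray. Moving them
  -- back one period embeds its cone in that of `ray (n + 1 - d)`.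
  set φ : V → V := P.piecewise Φ id with hφ
  have hside : ∀ c, A.up c = A.ray (q + d + 1) → φ c ∈ A.side (q + d + 1) := by
    intro c hc
    by_cases hcP : c ∈ P
    · rw [hφ, piecewise_eq_of_mem _ _ _ hcP]; exact (hm hcP).2
    · rw [hφ, piecewise_eq_of_notMem _ _ _ hcP]
      rcases mem_side_or_eq hc with h | rfl
      · exact h
      · exact absurd hrP hcP
  have hinj : Injective φ := by
    rw [hφ, injective_piecewise_iff]
    refine ⟨hi, injOn_id _, fun x hx y hy hxy => hy ?_⟩
    rw [← show Φ x = y from hxy]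
    exact (hm hx).1
  have hlep : ∀ c, A.Le c (φ c) := by
    intro c
    by_cases hcP : c ∈ P
    · rw [hφ, piecewise_eq_of_mem _ _ _ hcP]; exact hle c hcP
    · rw [hφ, piecewise_eq_of_notMem _ _ _ hcP]; exact Le.refl _
  have := le_of_children (A := A) (x := A.ray (q + d + 1)) (y := A.ray (q + 1)) (φ := η ∘ φ)
    (hη.comp hinj.injOn hside) (fun c hc => (hηm (hside c hc)).1)
    (fun c hc => (hlep c).trans (hηl _ (hside c hc)))
  refine h.not_ray_le_ray (q := q + 1) (k := 1) (by omega) one_pos ?_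
  rwa [mul_one, show q + 1 + d = q + d + 1 by omega]

/-- Some embedding shifts the ray beyond the `n`-th vertex by a multiple of `d`, but takes the
`n`-th vertex off the ray. -/
def Branches (A : Ascent V) (d n : ℕ) : Prop :=
  ∃ f e, A.IsEmb f ∧ (∀ i, n < i → f (A.ray i) = A.ray (i + d * e)) ∧
    f (A.ray n) ≠ A.ray (n + d * e)

/-- Otherwise `f` would send every child above `ray n` to an off-ray child, and periodicity would
bring the images back to `ray (n + 1)`, making a hotel. -/
lemma exists_side_between (h : A.Periodic d N) {n : ℕ} (hn : N + d ≤ n) (hb : Branches A d n) :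
    ∃ e, ∃ v ∈ A.side (n + 1), A.Le (A.ray n) v ∧ A.Le v (A.ray (n + d * e)) := by
  obtain ⟨f, e, hf, hs, hne⟩ := hb
  refine ⟨e, ?_⟩
  by_contra! hcon
  obtain ⟨η, hη, hηm, hηl⟩ := h.sideLe_mul (n := n + 1) (by omega) e
  set P : Set V := {c | A.up c = A.ray (n + 1) ∧ A.Le (A.ray n) c} with hP
  have hfP : MapsTo f P (A.side (n + 1 + d * e)) := by
    intro c hc
    have h1 : A.up (f c) = A.ray (n + 1 + d * e) := by rw [← hf.comm, hc.1, hs _ (by omega)]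
    refine ⟨h1, fun i hi => ?_⟩
    rw [hi, A.up_ray, A.ray_inj] at h1
    obtain rfl : i = n + d * e := by omega
    rcases mem_side_or_eq hc.1 with h2 | rfl
    · exact hcon c h2 hc.2 (hi ▸ hf.le c)
    · exact hne hi
  refine h.no_hotel hn (P := P) (Φ := η ∘ f) ⟨A.up_ray n, Le.refl _⟩ (hη.comp hf.inj.injOn hfP)
    (fun c hc => ?_) (fun c hc => (hf.le c).trans (hηl _ (hfP hc)))
  exact ⟨⟨(hηm (hfP hc)).1, (hc.2.trans (hf.le c)).trans (hηl _ (hfP hc))⟩, hηm (hfP hc)⟩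

/-- Move the off-ray children back by `d * j` with `η` and forward again with `ζ`. If no `u`
existed, `ζ ∘ η` would miss `v` on the relevant children, leaving `v` free for the ray child: a
hotel. -/
lemma exists_side_between_transfer (h : A.Periodic d N) {n j e : ℕ} (hn : N + d ≤ n) {v : V}
    (hv : v ∈ A.side (n + d * j + 1)) (h1 : A.Le (A.ray (n + d * j)) v)
    (h2 : A.Le v (A.ray (n + d * j + d * e))) :
    ∃ u ∈ A.side (n + 1), A.Le (A.ray (n + d * j)) u ∧ A.Le u (A.ray (n + d * (j + e))) := by
  classical
  rw [show n + d * (j + e) = n + d * j + d * e by ring]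
  by_contra! hcon
  obtain ⟨η, hη, hηm, hηl⟩ := h.sideLe_mul (n := n + 1) (by omega) j
  obtain ⟨ζ, hζ, hζm, hζl⟩ := h.sideLe_add_mul (n := n) (by omega) j
  rw [show n + 1 + d * j = n + d * j + 1 by ring] at *
  set m := n + d * j with hm
  set P : Set V := {c | A.up c = A.ray (m + 1) ∧ A.Le (A.ray m) c} with hP
  have hPs : ∀ c ∈ P, c ≠ A.ray m → c ∈ A.side (m + 1) := fun c hc hne =>
    (mem_side_or_eq hc.1).resolve_right hne
  set θ : V → V := fun c => if c = A.ray m then v else ζ (η c) with hθ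
  have θpos : θ (A.ray m) = v := if_pos rfl
  have θneg : ∀ c, c ≠ A.ray m → θ c = ζ (η c) := fun c hc => if_neg hc
  have hvθ : ∀ c ∈ P, c ≠ A.ray m → ζ (η c) ≠ v := fun c hc hne hcv => by
    have hcs := hPs c hc hne
    exact hcon (η c) (hηm hcs) (hc.2.trans (hηl c hcs))
      ((hcv ▸ hζl _ (hηm hcs) : A.Le (η c) v).trans h2)
  have hle : ∀ c ∈ P, A.Le c (θ c) := by
    intro c hc
    by_cases hne : c = A.ray m
    · rw [hne, θpos]; exact h1
    · rw [θneg c hne]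
      exact (hηl c (hPs c hc hne)).trans (hζl _ (hηm (hPs c hc hne)))
  refine h.no_hotel (n := m) (by omega) (P := P) (Φ := θ) ⟨A.up_ray m, Le.refl _⟩ ?_ ?_ hle
  · intro c hc c' hc' hcc
    by_cases hne : c = A.ray m <;> by_cases hne' : c' = A.ray m
    · rw [hne, hne']
    · rw [hne, θpos, θneg c' hne'] at hcc
      exact absurd hcc.symm (hvθ c' hc' hne')
    · rw [hne', θpos, θneg c hne] at hcc
      exact absurd hcc (hvθ c hc hne)
    · rw [θneg c hne, θneg c' hne'] at hcc
      exact hη (hPs c hc hne) (hPs c' hc' hne')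
        (hζ (hηm (hPs c hc hne)) (hηm (hPs c' hc' hne')) hcc)
  · intro c hc
    have hs : θ c ∈ A.side (m + 1) := by
      by_cases hne : c = A.ray m
      · rw [hne, θpos]; exact hv
      · rw [θneg c hne]; exact hζm (hηm (hPs c hc hne))
    exact ⟨⟨hs.1, hc.2.trans (hle c hc)⟩, hs⟩

/-- Branchings in one residue class mod `d` give sandwiched children of a single vertex `ray (n +
1)`. Choosing the sandwiches successively higher makes these children distinct and increasing, so
`ray n` can enter the chain at its bottom. -/
lemma not_frequently_branches (h : A.Periodic d N) : ¬ ∀ M, ∃ n, M ≤ n ∧ Branches A d n := by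
  classical
  intro hb
  obtain ⟨r, hr⟩ : ∃ r, ∀ M, ∃ n, M ≤ n ∧ n % d = r ∧ Branches A d n := by
    by_contra! hcon
    choose M hM using hcon
    obtain ⟨n, hn, hbn⟩ := hb ((Finset.range d).sup M)
    exact hM (n % d) n ((Finset.le_sup (Finset.mem_range.2 (Nat.mod_lt _ h.pos))).trans hn) rfl hbn
  obtain ⟨n, hn, hnr, -⟩ := hr (N + d)
  have key : ∀ J, ∃ j m, ∃ u ∈ A.side (n + 1), J ≤ j ∧ j ≤ m ∧
      A.Le (A.ray (n + d * j)) u ∧ A.Le u (A.ray (n + d * m)) := by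
    intro J
    obtain ⟨p, hp, hpr, hbp⟩ := hr (n + d * J)
    obtain ⟨j, hj⟩ : d ∣ p - n := (Nat.modEq_iff_dvd' (by omega)).1 (hnr.trans hpr.symm)
    obtain rfl : p = n + d * j := by omega
    obtain ⟨e, v, hv, h1, h2⟩ := h.exists_side_between (by omega) hbp
    obtain ⟨u, hu, h3, h4⟩ := h.exists_side_between_transfer hn hv h1 h2
    exact ⟨j, j + e, u, hu, Nat.le_of_mul_le_mul_left (by omega) h.pos, by omega, h3, h4⟩
  choose j m u hu hJ hjm hju hum using key
  -- Each sandwich starts strictly above the top of the preceding one. A repeated child would then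
  -- embed a ray cone in an earlier one.
  set J : ℕ → ℕ := fun i => (fun J => m J + 1)^[i] 0 with hJdef
  have Jsucc : ∀ i, J (i + 1) = m (J i) + 1 := fun i => iterate_succ_apply' _ _ _
  have Jmono : StrictMono J := strictMono_nat_of_lt_succ fun i => by
    rw [Jsucc]; have := hJ (J i); have := hjm (J i); omega
  set w : ℕ → V := fun i => u (J i) with hw
  have wne : ∀ i k, i < k → w i ≠ w k := by
    intro i k hik heq
    have h1 : m (J i) < j (J k) := by
      have := Jmono.monotone (show i + 1 ≤ k from hik)
      rw [Jsucc] at this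
      have := hJ (J k); omega
    have h2 := hum (J i)
    rw [show u (J i) = u (J k) from heq] at h2
    replace h2 := (hju (J k)).trans h2
    obtain ⟨t, ht⟩ : ∃ t, j (J k) = m (J i) + t := ⟨_, (Nat.add_sub_of_le h1.le).symm⟩
    refine h.not_ray_le_ray (q := n + d * m (J i)) (k := t) (by omega) (by omega) ?_
    rwa [ht, mul_add, ← add_assoc] at h2
  have winj : Injective w := fun i k hik => by
    rcases lt_trichotomy i k with hlt | rfl | hlt
    · exact absurd hik (wne i k hlt)
    · rfl
    · exact absurd hik.symm (wne k i hlt)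
  have rle : ∀ a b, a ≤ b → A.Le (A.ray (n + d * a)) (A.ray (n + d * b)) := by
    intro a b hab
    have := h.ray_le_ray (n := n + d * a) (by omega) (b - a)
    rwa [add_assoc, ← mul_add, Nat.add_sub_of_le hab] at this
  have wle : ∀ i, A.Le (w i) (w (i + 1)) := fun i =>
    ((hum (J i)).trans (rle _ _ (by have := hJ (J (i + 1)); rw [Jsucc] at *; omega))).trans
      (hju (J (i + 1)))
  have wray : ∀ i, w i ≠ A.ray n := fun i => (hu (J i)).2 n
  set Φ : V → V := fun c => if c = A.ray n then w 0 else w (invFun w c + 1) with hΦ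
  have Φray : Φ (A.ray n) = w 0 := if_pos rfl
  have Φw : ∀ i, Φ (w i) = w (i + 1) := fun i => by
    rw [hΦ]; simp only [if_neg (wray i), leftInverse_invFun winj i]
  refine h.no_hotel hn (P := insert (A.ray n) (range w)) (Φ := Φ) (mem_insert _ _) ?_ ?_ ?_
  · rintro _ (rfl | ⟨i, rfl⟩) _ (rfl | ⟨k, rfl⟩) hik
    · rfl
    · rw [Φray, Φw] at hik; exact absurd (winj hik) (by omega)
    · rw [Φray, Φw] at hik; exact absurd (winj hik) (by omega)
    · rw [Φw, Φw] at hik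
      rw [Nat.succ_injective (winj hik)]
  · rintro _ (rfl | ⟨i, rfl⟩)
    · rw [Φray]; exact ⟨Or.inr ⟨_, rfl⟩, hu _⟩
    · rw [Φw]; exact ⟨Or.inr ⟨_, rfl⟩, hu _⟩
  · rintro _ (rfl | ⟨i, rfl⟩)
    · rw [Φray]
      have := rle 0 (j (J 0)) (Nat.zero_le _)
      rw [mul_zero, add_zero] at this
      exact this.trans (hju (J 0))
    · rw [Φw]; exact wle i

/-- A tail of the ray is preserved by all embeddings. -/
theorem exists_preserved_tail (h : A.Periodic d N) :
    ∃ M, ∀ f, A.IsEmb f → ∃ c, f (A.ray M) = A.ray (M + c) := by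
  classical
  by_contra! hcon
  refine h.not_frequently_branches fun M => ?_
  obtain ⟨f, hf, hfM⟩ := hcon (max M N)
  obtain ⟨c, n₀, hc⟩ := h.shift f hf
  obtain ⟨t, ht, hts⟩ := h.translate
  have hex : ∃ K, ∀ i, K ≤ i → f (A.ray i) = A.ray (i + c) := ⟨n₀, hc⟩
  -- `K` is the first index from which `f` is a pure shift, so `f` departs from this shift exactly
  -- at `K - 1`.
  have hKs := Nat.find_spec hex
  have hKm := fun K => Nat.find_min (m := K) hex
  set K := Nat.find hex
  have hMK : max M N < K := by
    by_contra hle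
    exact hfM c (hKs _ (not_lt.1 hle))
  clear_value K
  obtain ⟨n, rfl⟩ : ∃ n, K = n + 1 := ⟨K - 1, by omega⟩
  have hne : f (A.ray n) ≠ A.ray (n + c) := fun heq =>
    hKm n (by omega) fun i hi => by
      rcases hi.eq_or_lt with rfl | hlt
      · exact heq
      · exact hKs i hlt
  -- Composing with `t` makes the shift `c + d` positive, so that it sends `ray n` to an index where
  -- `t ∘ f` is already known to shift. Injectivity then keeps the iterates from returning to the
  -- shift at `n`.
  have hg : A.IsEmb (t ∘ f) := ht.comp hf
  have hgs : ∀ i, n + 1 ≤ i → (t ∘ f) (A.ray i) = A.ray (i + (c + d)) := fun i hi => by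
    rw [comp_apply, hKs i hi, hts _ (by omega), add_assoc]
  have hgne : (t ∘ f) (A.ray n) ≠ A.ray (n + (c + d)) := fun heq => by
    rw [comp_apply, ← add_assoc, ← hts (n + c) (by omega)] at heq
    exact hne (ht.inj heq)
  have hit : ∀ k, (t ∘ f)^[k + 1] (A.ray n) ≠ A.ray (n + (c + d) * (k + 1)) := by
    intro k
    induction k with
    | zero => simpa using hgne
    | succ k ih =>
      intro heq
      have hpos := h.pos
      have hlt : n + 1 ≤ n + (c + d) * (k + 1) := by
        have : 0 < (c + d) * (k + 1) := by positivity
        omega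
      rw [iterate_succ_apply', show n + (c + d) * (k + 1 + 1) = n + (c + d) * (k + 1) + (c + d) by
        ring, ← hgs _ hlt] at heq
      exact ih (hg.inj heq)
  -- The `d`-th iterate turns the shift `c + d` into a multiple of `d`.
  refine ⟨n, by omega, (t ∘ f)^[d], c + d, hg.iterate d, fun i hi => ?_, ?_⟩
  · rw [mul_comm]; exact IsEmb.iterate_ray_shift hgs d hi
  · have := hit (d - 1)
    rwa [Nat.sub_add_cancel h.pos, mul_comm] at this

end Periodic
end Ascent
variable {T : SimpleGraph V}

/-! ### Orienting a tree towards an end. -/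

section Orientation

lemma eq_of_adj_of_dist_eq (hT : T.IsTree) {z v w w' : V} (h : T.Adj v w) (h' : T.Adj v w')
    (hd : T.dist z v = T.dist z w + 1) (hd' : T.dist z v = T.dist z w' + 1) : w = w' := by
  have key : ∀ {x}, (hx : T.Adj v x) → T.dist z v = T.dist z x + 1 →
      ∃ p : T.Walk x z, (SimpleGraph.Walk.cons hx p).IsPath := by
    intro x hx hdx
    obtain ⟨p, hp⟩ := hT.connected.exists_walk_length_eq_dist x z
    refine ⟨p, SimpleGraph.Walk.isPath_of_length_eq_dist _ ?_⟩
    rw [SimpleGraph.Walk.length_cons, hp, T.dist_comm, T.dist_comm (u := v), hdx]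
  obtain ⟨p, hp⟩ := key h hd
  obtain ⟨q, hq⟩ := key h' hd'
  have := congrArg SimpleGraph.Walk.snd ((hT.existsUnique_path v z).unique hp hq)
  simpa using this

namespace Ray

variable (R : Ray T)

/-- The distance to `v` increases when passing from the `n`-th vertex of `R` to the next one. -/
def Recedes (v : V) (n : ℕ) : Prop :=
  T.dist (R.vertex (n + 1)) v = T.dist (R.vertex n) v + 1

variable {R}

/-- If the distance to `v` dropped after rising, `R.vertex (n + 1)` would have two neighbours closer
to `v`, forced to coincide in a tree. -/
lemma Recedes.succ (hT : T.IsTree) {v : V} {n : ℕ} (h : R.Recedes v n) : R.Recedes v (n + 1) := by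
  unfold Recedes at *
  rcases hT.dist_eq_dist_add_one_of_adj v (R.adj (n + 1)) with h1 | h1
  · rw [T.dist_comm, T.dist_comm (u := R.vertex n)] at h
    have := R.injective (eq_of_adj_of_dist_eq hT (R.adj n).symm (R.adj (n + 1)) h h1)
    omega
  · rw [T.dist_comm, h1, T.dist_comm]

lemma Recedes.mono (hT : T.IsTree) {v : V} {n m : ℕ} (h : R.Recedes v n) (hnm : n ≤ m) :
    R.Recedes v m := by
  induction hnm with
  | refl => exact h
  | step _ ih => exact ih.succ hT

lemma Recedes.dist_add (hT : T.IsTree) {v : V} {n : ℕ} (h : R.Recedes v n) (k : ℕ) :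
    T.dist (R.vertex (n + k)) v = T.dist (R.vertex n) v + k := by
  induction k with
  | zero => rfl
  | succ k ih =>
    have := h.mono hT (Nat.le_add_right n k)
    unfold Recedes at this
    rw [← add_assoc, this, ih, add_assoc]

lemma exists_recedes (hT : T.IsTree) (R : Ray T) (v : V) : ∃ n, R.Recedes v n := by
  by_contra! hcon
  have key : ∀ n, T.dist (R.vertex 0) v = T.dist (R.vertex n) v + n := by
    intro n
    induction n with
    | zero => rfl
    | succ n ih =>
      rcases hT.dist_eq_dist_add_one_of_adj v (R.adj n) with h1 | h1
      · rw [T.dist_comm, T.dist_comm (v := R.vertex (n + 1))] at h1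
        rw [ih, h1]; ring
      · rw [T.dist_comm, T.dist_comm (v := R.vertex n)] at h1
        exact absurd h1 (hcon n)
  have := key (T.dist (R.vertex 0) v + 1)
  omega

/-- `w` is the neighbour of `v` in the direction of the end of `R`. -/
def IsUp (R : Ray T) (v w : V) : Prop :=
  T.Adj v w ∧ ∃ n₀, ∀ n, n₀ ≤ n → T.dist (R.vertex n) v = T.dist (R.vertex n) w + 1

lemma IsUp.unique (hT : T.IsTree) {v w w' : V} (h : R.IsUp v w) (h' : R.IsUp v w') : w = w' := by
  obtain ⟨ha, n, hn⟩ := h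
  obtain ⟨ha', n', hn'⟩ := h'
  exact eq_of_adj_of_dist_eq hT ha ha' (hn _ (le_max_left n n')) (hn' _ (le_max_right n n'))

lemma isUp_of_recedes (hT : T.IsTree) {v w : V} {n : ℕ} (ha : T.Adj v w) (hv : R.Recedes v n)
    (hw : R.Recedes w n) (hd : T.dist (R.vertex n) v = T.dist (R.vertex n) w + 1) :
    R.IsUp v w := by
  refine ⟨ha, n, fun m hm => ?_⟩
  obtain ⟨k, rfl⟩ := Nat.exists_eq_add_of_le hm
  rw [hv.dist_add hT, hw.dist_add hT, hd]; ring

lemma Recedes.exists_isUp (hT : T.IsTree) {v : V} {n k : ℕ} (h : R.Recedes v n)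
    (hk : T.dist (R.vertex n) v = k + 1) :
    ∃ w, R.IsUp v w ∧ R.Recedes w n ∧ T.dist (R.vertex n) w = k := by
  obtain ⟨p, hp⟩ := hT.connected.exists_walk_length_eq_dist v (R.vertex n)
  rw [T.dist_comm, hk] at hp
  cases p with
  | nil => simp at hp
  | @cons _ w _ ha p =>
    rw [SimpleGraph.Walk.length_cons] at hp
    have h1 : T.dist (R.vertex n) w ≤ k := by
      rw [T.dist_comm]; exact (SimpleGraph.dist_le p).trans (by omega)
    have h2 : T.dist (R.vertex n) w = k := by
      rcases hT.dist_eq_dist_add_one_of_adj (R.vertex n) ha with h2 | h2 <;> omega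
    have h3 : R.Recedes w n := by
      have hv := h
      unfold Recedes at h ⊢
      rcases hT.dist_eq_dist_add_one_of_adj (R.vertex (n + 1)) ha with h3 | h3
      · omega
      · rcases hT.dist_eq_dist_add_one_of_adj w (R.adj n) with h4 | h4 <;>
        rw [T.dist_comm, T.dist_comm (u := w)] at h4 <;> omega
    exact ⟨w, isUp_of_recedes hT ha h h3 (by omega), h3, h2⟩

lemma exists_isUp (hT : T.IsTree) (R : Ray T) (v : V) : ∃ w, R.IsUp v w := by
  obtain ⟨n, hn⟩ := exists_recedes hT R v
  -- At index `n + 1` the distance to `v` is positive, so there is a first step to take.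
  obtain ⟨w, hw, -⟩ := (hn.succ hT).exists_isUp hT hn
  exact ⟨w, hw⟩

lemma isUp_or_isUp (hT : T.IsTree) (R : Ray T) {v w : V} (ha : T.Adj v w) :
    R.IsUp v w ∨ R.IsUp w v := by
  obtain ⟨n, hn⟩ := exists_recedes hT R v
  obtain ⟨m, hm⟩ := exists_recedes hT R w
  replace hn := hn.mono hT (le_max_left n m)
  replace hm := hm.mono hT (le_max_right n m)
  exact (hT.dist_eq_dist_add_one_of_adj _ ha).imp (isUp_of_recedes hT ha hn hm)
    (isUp_of_recedes hT ha.symm hm hn)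

lemma isUp_vertex (hT : T.IsTree) (R : Ray T) (n : ℕ) : R.IsUp (R.vertex n) (R.vertex (n + 1)) := by
  have h0 : R.Recedes (R.vertex n) n := by
    unfold Recedes
    rw [T.dist_self, SimpleGraph.dist_eq_one_iff_adj]; exact (R.adj n).symm
  refine ⟨R.adj n, n + 1, fun m hm => ?_⟩
  have h1 : R.Recedes (R.vertex (n + 1)) (n + 1) := by
    unfold Recedes
    rw [T.dist_self, SimpleGraph.dist_eq_one_iff_adj]; exact (R.adj (n + 1)).symm
  obtain ⟨k, rfl⟩ := Nat.exists_eq_add_of_le hm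
  rw [h1.dist_add hT, add_assoc, h0.dist_add hT, T.dist_self, T.dist_self]; ring

/-- A tree is oriented towards the end of any of its rays. -/
theorem exists_ascent (hT : T.IsTree) (R : Ray T) :
    ∃ A : Ascent V, A.ray = R.vertex ∧ ∀ v w, T.Adj v w ↔ w = A.up v ∨ v = A.up w := by
  choose up hup using exists_isUp hT R
  have up_eq : ∀ {v w}, R.IsUp v w → up v = w := fun h => (hup _).unique hT h
  have hray : ∀ n, up (R.vertex n) = R.vertex (n + 1) := fun n => up_eq (isUp_vertex hT R n)
  have hrayk : ∀ k n, up^[k] (R.vertex n) = R.vertex (n + k) := by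
    intro k n
    induction k with
    | zero => rfl
    | succ k ih => rw [iterate_succ_apply', ih, hray]; rfl
  have hiter : ∀ k v n, R.Recedes v n → T.dist (R.vertex n) v = k → up^[k] v = R.vertex n := by
    intro k
    induction k with
    | zero => intro v n _ hd; exact (hT.connected.dist_eq_zero_iff.1 hd).symm
    | succ k ih =>
      intro v n hv hd
      obtain ⟨w, hw, hwn, hwd⟩ := hv.exists_isUp hT hd
      rw [iterate_succ_apply, up_eq hw, ih w n hwn hwd]
  have hex : ∀ v, ∃ k m, up^[k] v = R.vertex m := fun v => by
    obtain ⟨n, hn⟩ := exists_recedes hT R v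
    exact ⟨_, n, hiter _ v n hn rfl⟩
  choose k m hkm using hex
  -- The level `m - k` does not depend on where the upward path from `v` is seen to meet the ray.
  have hlev : ∀ {v k' m'}, up^[k'] v = R.vertex m' → (m v : ℤ) - k v = m' - k' := by
    intro v k' m' h
    have h1 : up^[k' + k v] v = R.vertex (m v + k') := by
      rw [iterate_add_apply, hkm, hrayk]
    have h2 : up^[k' + k v] v = R.vertex (m' + k v) := by
      rw [add_comm, iterate_add_apply, h, hrayk]
    have := R.injective (h1.symm.trans h2)
    omega
  refine ⟨⟨up, fun v => (m v : ℤ) - k v, fun v => ?_, R.vertex, hray, fun v => ⟨_, _, hkm v⟩⟩, rfl,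
    fun v w => ⟨fun h => ?_, ?_⟩⟩
  · have : up^[k v] (up v) = R.vertex (m v + 1) := by
      rw [← iterate_succ_apply, iterate_succ_apply', hkm, hray]
    have := hlev this
    push_cast at this
    omega
  · exact (isUp_or_isUp hT R h).imp (fun h => (up_eq h).symm) (fun h => (up_eq h).symm)
  · rintro (rfl | rfl)
    · exact (hup v).1
    · exact (hup w).1.symm

end Ray
end Orientation

/-! ### Rays and embeddings relative to the orientation. -/

variable (T) in
/-- The edges of `T` join each vertex to the next one towards the end. -/
def Ascent.Orients (A : Ascent V) : Prop := ∀ v w, T.Adj v w ↔ w = A.up v ∨ v = A.up w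

namespace Ascent

variable {A : Ascent V}

/-- The ray that leads from `v` towards the end. -/
def rayFrom (hA : A.Orients T) (v : V) : Ray T where
  vertex i := A.up^[i] v
  injective i j h := by
    have := congrArg A.level h
    simp only [A.level_iterate] at this
    omega
  adj i := (hA _ _).2 (Or.inl (iterate_succ_apply' _ _ _))

/-- The image of a ray under an embedding. -/
def mapRay (f : Emb T) (S : Ray T) : Ray T where
  vertex i := f (S.vertex i)
  injective := f.injective.comp S.injective
  adj i := f.toHom.map_adj (S.adj i)

/-- After one downward step a ray can never turn up, as it would revisit a vertex. Its levels then
tend to `-∞`, while those of `B` are bounded below, so only finitely many vertices are shared. -/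
lemma ascends_of_infinite (hA : A.Orients T) {S : Ray T} {B : ℕ → V}
    (hB : ∀ i, A.up (B i) = B (i + 1)) (hinf : (S.verts ∩ range B).Infinite) (i : ℕ) :
    A.up (S.vertex i) = S.vertex (i + 1) := by
  by_contra hne
  have hdown : ∀ k, S.vertex (i + k) = A.up (S.vertex (i + k + 1)) := by
    intro k
    induction k with
    | zero => exact ((hA _ _).1 (S.adj i)).resolve_left (Ne.symm hne)
    | succ k ih =>
      refine ((hA _ _).1 (S.adj (i + k + 1))).resolve_left fun h => ?_
      have := S.injective (ih.trans h.symm)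
      omega
  have hlev : ∀ k, A.level (S.vertex (i + k)) = A.level (S.vertex i) - k := by
    intro k
    induction k with
    | zero => simp
    | succ k ih =>
      have := A.level_up (S.vertex (i + k + 1))
      rw [← hdown, ih] at this
      rw [← add_assoc]; push_cast; omega
  have hlevB : ∀ k, A.level (B k) = A.level (B 0) + k := by
    intro k
    induction k with
    | zero => simp
    | succ k ih => rw [← hB, A.level_up, ih]; push_cast; ring
  refine hinf (((finite_Iio (i + (A.level (S.vertex i) - A.level (B 0)).toNat + 1)).image
    S.vertex).subset ?_)
  rintro _ ⟨⟨j, rfl⟩, k, hk⟩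
  refine ⟨j, ?_, rfl⟩
  rw [mem_Iio]
  by_contra hj
  obtain ⟨l, rfl⟩ := Nat.exists_eq_add_of_le (show i ≤ j by omega)
  have h1 := hlevB k
  rw [hk, hlev l] at h1
  omega

lemma up_iterate_of_ascends {S : Ray T} (hS : ∀ i, A.up (S.vertex i) = S.vertex (i + 1))
    (k i : ℕ) : A.up^[k] (S.vertex i) = S.vertex (i + k) := by
  induction k with
  | zero => rfl
  | succ k ih => rw [iterate_succ_apply', ih, hS]; rfl

lemma ascends_of_equivalent (hA : A.Orients T) {S S' : Ray T} (h : S.Equivalent S')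
    (hS : ∀ i, A.up (S.vertex i) = S.vertex (i + 1)) (i : ℕ) :
    A.up (S'.vertex i) = S'.vertex (i + 1) := by
  obtain ⟨Q, hQ⟩ := h
  refine ascends_of_infinite hA hS ?_ i
  rw [inter_comm]
  show (S.verts ∩ S'.verts).Infinite
  rw [← hQ]
  exact infinite_range_of_injective Q.injective

/-- An embedding that preserves forward a ray towards the end commutes with `up` and shifts a tail
of the distinguished ray. -/
lemma isEmb_of_preservesRay (hA : A.Orients T) {f : Emb T} {S : Ray T}
    (hS : ∀ i, A.up (S.vertex i) = S.vertex (i + 1)) (hf : f.PreservesRay S) :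
    A.IsEmb f ∧ ∃ c n₀, ∀ n, n₀ ≤ n → f (A.ray n) = A.ray (n + c) := by
  have hfS : ∀ i, f (S.vertex i) ∈ S.verts := fun i => hf ⟨_, ⟨i, rfl⟩, rfl⟩
  have hemb : A.IsEmb f := by
    refine ⟨f.injective, fun v => ?_⟩
    obtain ⟨a, m, hv⟩ := A.exists_iterate v
    obtain ⟨b, m', hb⟩ := A.exists_iterate (S.vertex 0)
    have hmeet : A.up^[m' + a] v = S.vertex (b + m) := by
      rw [iterate_add_apply, hv, A.iterate_ray, add_comm m m', ← A.iterate_ray, ← hb,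
        ← iterate_add_apply, up_iterate_of_ascends hS]
      congr 1; omega
    -- The upward ray from `v` merges into `S`, which `f` preserves. Hence its image meets `S`
    -- infinitely often and ascends, and the first step of that ascent is the claim.
    have hinf : ((mapRay f (rayFrom hA v)).verts ∩ range S.vertex).Infinite := by
      refine (infinite_range_of_injective (f := fun i => f (S.vertex (b + m + i)))
        fun i j h => ?_).mono ?_
      · have := S.injective (f.injective h)
        omega
      · rintro _ ⟨i, rfl⟩
        refine ⟨⟨i + (m' + a), ?_⟩, hfS _⟩
        show f (A.up^[i + (m' + a)] v) = _
        rw [iterate_add_apply, hmeet, up_iterate_of_ascends hS]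
    exact (ascends_of_infinite hA hS hinf 0).symm
  refine ⟨hemb, ?_⟩
  obtain ⟨c, hc⟩ := hfS 0
  obtain ⟨b, m, hb⟩ := A.exists_iterate (S.vertex 0)
  have hm : f (A.ray m) = A.ray (m + c) := by
    rw [← hb, hemb.up_iterate, ← hc, ← A.iterate_ray, ← hb, ← iterate_add_apply,
      up_iterate_of_ascends hS, up_iterate_of_ascends hS]
    congr 1; omega
  refine ⟨c, m, fun n hn => ?_⟩
  obtain ⟨k, rfl⟩ := Nat.exists_eq_add_of_le hn
  rw [hemb.ray_add hm]; congr 1; omega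

/-- A self-map commuting with `up` as an embedding of the tree. -/
def IsEmb.toEmb (hA : A.Orients T) {g : V → V} (hg : A.IsEmb g) : Emb T :=
  ⟨⟨g, fun {v w} h => (hA _ _).2 <| ((hA v w).1 h).imp (fun h => by rw [h, hg.comm])
    (fun h => by rw [h, hg.comm])⟩, hg.inj⟩

/-! ### From regularity to periodicity. -/

section Hanging

variable {R : Ray T}

lemma offRay_adj_iff (hA : A.Orients T) (hR : A.ray = R.vertex) {v w : V} :
    R.offRay.Adj v w ↔ (w = A.up v ∧ ∀ i, v ≠ A.ray i) ∨ (v = A.up w ∧ ∀ i, w ≠ A.ray i) := by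
  have key : ∀ v, s(v, A.up v) ∈ R.edges ↔ ∃ i, v = A.ray i := by
    intro v
    unfold Ray.edges
    rw [← hR]
    constructor
    · rintro ⟨i, hi⟩
      have hi : s(A.ray i, A.ray (i + 1)) = s(v, A.up v) := hi
      rcases Sym2.eq_iff.1 hi with ⟨h, -⟩ | ⟨h1, h2⟩
      · exact ⟨i, h.symm⟩
      · exact ⟨i + 1, h2.symm⟩
    · rintro ⟨i, rfl⟩
      exact ⟨i, by rw [A.up_ray]⟩
  unfold Ray.offRay
  rw [SimpleGraph.deleteEdges_adj, hA v w]
  constructor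
  · rintro ⟨rfl | rfl, h⟩
    · rw [key, not_exists] at h; exact Or.inl ⟨rfl, h⟩
    · rw [Sym2.eq_swap, key, not_exists] at h; exact Or.inr ⟨rfl, h⟩
  · rintro (⟨rfl, h⟩ | ⟨rfl, h⟩)
    · refine ⟨Or.inl rfl, ?_⟩
      rwa [key, not_exists]
    · refine ⟨Or.inr rfl, ?_⟩
      rwa [Sym2.eq_swap, key, not_exists]

lemma ne_ray_of_mem_below_side {n : ℕ} {c v : V} (hc : c ∈ A.side n) (hv : v ∈ A.below c) (i : ℕ) :
    v ≠ A.ray i := by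
  rintro rfl
  obtain ⟨k, hk⟩ := hv
  exact hc.2 (i + k) (by rw [← hk, A.iterate_ray])

lemma mem_hangingSet (hA : A.Orients T) (hR : A.ray = R.vertex) {n : ℕ} {c v : V}
    (hc : c ∈ A.side n) (hv : v ∈ A.below c) : v ∈ R.hangingSet (A.ray n) := by
  obtain ⟨k, hk⟩ := hv
  induction k generalizing v with
  | zero =>
    obtain rfl : v = c := hk
    exact ((offRay_adj_iff hA hR).2 (Or.inr ⟨hc.1.symm, hc.2⟩)).reachable
  | succ k ih =>
    refine SimpleGraph.Reachable.trans (ih (v := A.up v) hk) ?_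
    exact ((offRay_adj_iff hA hR).2
      (Or.inr ⟨rfl, ne_ray_of_mem_below_side hc ⟨k + 1, hk⟩⟩)).reachable

/-- A rooted embedding commutes with `up` below the root, by induction on depth: reversing an edge
would give `v` and its second ancestor the same image. -/
lemma sideLe_of_rootedEmbeds (hA : A.Orients T) (hR : A.ray = R.vertex) {n m : ℕ}
    (h : RootedEmbeds (R.hangingTree (R.vertex n)) (R.hangingRoot (R.vertex n))
      (R.hangingTree (R.vertex m)) (R.hangingRoot (R.vertex m))) : A.SideLe n m := by
  classical
  obtain ⟨f, hf⟩ := h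
  set H := R.hangingSet (R.vertex n) with hH
  set g : V → V := fun v => if hv : v ∈ H then f ⟨v, hv⟩ else v with hg
  have g_eq : ∀ {v} (hv : v ∈ H), g v = f ⟨v, hv⟩ := fun hv => dif_pos hv
  have ginj : InjOn g H := fun v hv w hw hvw => by
    rw [g_eq hv, g_eq hw] at hvw
    exact congrArg Subtype.val (f.injective (Subtype.ext hvw))
  have groot : g (A.ray n) = A.ray m := by
    rw [hR, g_eq (SimpleGraph.Reachable.refl _)]
    exact congrArg Subtype.val hf
  have gadj : ∀ {v w}, v ∈ H → w ∈ H → R.offRay.Adj v w → R.offRay.Adj (g v) (g w) := by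
    intro v w hv hw hvw
    rw [g_eq hv, g_eq hw]
    exact f.toHom.map_adj (v := ⟨v, hv⟩) (w := ⟨w, hw⟩) hvw
  have hbelow : ∀ {c v}, c ∈ A.side n → v ∈ A.below c → v ∈ H := fun hc hv => by
    rw [hH, ← hR]; exact mem_hangingSet hA hR hc hv
  have hrootH : A.ray n ∈ H := by rw [hR]; exact SimpleGraph.Reachable.refl _
  have hbelow' : ∀ {c v}, c ∈ A.side n → v ∈ A.below c → A.up v ∈ H := by
    intro c v hc hv
    by_cases hvc : v = c
    · rw [hvc, hc.1]; exact hrootH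
    · exact hbelow hc (A.up_mem_below hv hvc)
  have hoff : ∀ {c v}, c ∈ A.side n → v ∈ A.below c → R.offRay.Adj (g v) (g (A.up v)) :=
    fun hc hv => gadj (hbelow hc hv) (hbelow' hc hv) ((offRay_adj_iff hA hR).2
      (Or.inl ⟨rfl, ne_ray_of_mem_below_side hc hv⟩))
  have hside : MapsTo g (A.side n) (A.side m) := by
    intro c hc
    have := hoff hc (A.mem_below_self c)
    rw [hc.1, groot, offRay_adj_iff hA hR] at this
    rcases this with ⟨h1, h2⟩ | ⟨-, h2⟩
    · exact ⟨h1.symm, h2⟩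
    · exact absurd rfl (h2 m)
  have hup : ∀ {c}, c ∈ A.side n → ∀ k v, A.up^[k] v = c → g (A.up v) = A.up (g v) := by
    intro c hc k
    induction k with
    | zero =>
      rintro v rfl
      have hv : v ∈ A.side n := hc
      rw [hv.1, groot, (hside hv).1]
    | succ k ih =>
      intro v hv
      have hvc : v ∈ A.below c := ⟨k + 1, hv⟩
      have huc : A.up v ∈ A.below c := ⟨k, hv⟩
      rcases (offRay_adj_iff hA hR).1 (hoff hc hvc) with ⟨h1, -⟩ | ⟨h1, -⟩
      · exact h1
      · rw [← ih (A.up v) hv] at h1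
        have h2 := congrArg A.level (ginj (hbelow hc hvc) (hbelow' hc huc) h1)
        rw [A.level_up, A.level_up] at h2
        omega
  refine ⟨g, ginj.mono fun c hc => hbelow hc (A.mem_below_self c), hside, fun c hc =>
    ⟨g, ⟨ginj.mono fun v hv => hbelow hc hv, fun v hv _ => ?_⟩, rfl⟩⟩
  obtain ⟨k, hk⟩ := hv
  exact hup hc k v hk

/-- The embedding `f` makes hanging trees grow along each residue class mod `d`. If `n < m` agree in
residue and equimorphy class, the tree at `n + d` embeds in that at `m`, hence in that at `n`. So
each pair of class and residue contains at most one failure of periodicity. -/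
lemma exists_periodic_of_isRegular (hA : A.Orients T) (hR : A.ray = R.vertex) (hreg : R.IsRegular)
    (hshift : ∀ f, A.IsEmb f → ∃ c n₀, ∀ n, n₀ ≤ n → f (A.ray n) = A.ray (n + c))
    {f : V → V} (hf : A.IsEmb f) {d n₀ : ℕ} (hd : 0 < d)
    (hfd : ∀ n, n₀ ≤ n → f (A.ray n) = A.ray (n + d)) : ∃ N, A.Periodic d N := by
  obtain ⟨F, hF⟩ := hreg
  choose col hcol heq using hF
  have h1 : ∀ n, A.SideLe n (col n) := fun n => sideLe_of_rootedEmbeds hA hR (heq n).1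
  have h2 : ∀ n, A.SideLe (col n) n := fun n => sideLe_of_rootedEmbeds hA hR (heq n).2
  have hmul : ∀ n k, n₀ < n → A.SideLe n (n + d * k) := by
    intro n k hn
    obtain ⟨n, rfl⟩ : ∃ i, n = i + 1 := ⟨n - 1, by omega⟩
    exact (hf.iterate k).sideLe (IsEmb.iterate_ray_shift hfd k (by omega))
  set X : Set ℕ := {n | n₀ < n ∧ ¬ A.SideLe (n + d) n} with hX
  have hlt : ∀ n ∈ X, ∀ m, n < m → col n = col m → n % d = m % d → False := by
    intro n hn m hnm hc hmod
    obtain ⟨k, hk⟩ : d ∣ m - n := (Nat.modEq_iff_dvd' hnm.le).1 hmod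
    obtain ⟨k, rfl⟩ : ∃ l, k = l + 1 := ⟨k - 1, by
      have : k ≠ 0 := by rintro rfl; omega
      omega⟩
    have hm : m = n + d + d * k := by rw [mul_add] at hk; omega
    refine hn.2 ((hmul (n + d) k (by have := hn.1; omega)).trans ?_)
    rw [← hm]
    exact (h1 m).trans (hc ▸ h2 n)
  have hfin : X.Finite := by
    refine Set.Finite.of_finite_image (f := fun n => (col n, n % d)) ?_ ?_
    · refine ((F ×ˢ Finset.range d).finite_toSet).subset ?_
      rintro _ ⟨n, -, rfl⟩
      simp [hcol, Nat.mod_lt n hd]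
    · intro n hn m hm hnm
      rw [Prod.mk.injEq] at hnm
      rcases lt_trichotomy n m with h | h | h
      · exact (hlt n hn m h hnm.1 hnm.2).elim
      · exact h
      · exact (hlt m hm n h hnm.1.symm hnm.2.symm).elim
  obtain ⟨b, hb⟩ := hfin.bddAbove
  refine ⟨max (b + 1) (n₀ + 1), hd, hshift, ⟨f, hf, fun n hn => hfd n (by omega)⟩, fun n hn => ?_⟩
  by_contra hcon
  have := hb (show n ∈ X from ⟨by omega, hcon⟩)
  omega

end Hanging

/-! ### The common preserved ray. -/

lemma exists_preserved_of_fixed (hA : A.Orients T) (hemb : ∀ f : Emb T, A.IsEmb f) {v : V}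
    (hv : ∀ f : Emb T, f v = v) : ∃ R : Ray T, ∀ f : Emb T, f.PreservesRay R := by
  refine ⟨rayFrom hA v, fun f => ?_⟩
  rintro _ ⟨_, ⟨i, rfl⟩, rfl⟩
  refine ⟨i, ?_⟩
  show A.up^[i] v = f (A.up^[i] v)
  rw [(hemb f).up_iterate, hv]

end Ascent
end TreeEnds

theorem mainTheorem8 {V : Type*} (T : SimpleGraph V) (hT : T.IsTree)
    (hreg : ∃ η : Set (TreeEnds.Ray T), TreeEnds.IsRegularEnd η ∧
      ∀ f : TreeEnds.Emb T, TreeEnds.Emb.PreservesEndForward f η)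
    (hfix : (∃ v : V, ∀ f : TreeEnds.Emb T, f v = v) ∨
      (∃ e ∈ T.edgeSet, ∀ f : TreeEnds.Emb T, Sym2.map f e = e) ∨
      (∃ f : TreeEnds.Emb T, ¬ TreeEnds.Emb.IsElliptic f)) :
    ∃ R : TreeEnds.Ray T, ∀ f : TreeEnds.Emb T, TreeEnds.Emb.PreservesRay f R := by
  obtain ⟨_, ⟨⟨R₀, rfl⟩, R, hRη, hRreg⟩, hpres⟩ := hreg
  obtain ⟨A, hR, hA⟩ := R.exists_ascent hT
  replace hA : A.Orients T := hA
  have hRup : ∀ i, A.up (R.vertex i) = R.vertex (i + 1) := fun i => by rw [← hR, A.up_ray]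
  have hR₀ : ∀ i, A.up (R₀.vertex i) = R₀.vertex (i + 1) := by
    obtain ⟨Q, hQ⟩ := hRη
    exact TreeEnds.Ascent.ascends_of_equivalent hA ⟨Q, hQ.trans (Set.inter_comm _ _)⟩ hRup
  have hall : ∀ f : TreeEnds.Emb T, A.IsEmb f ∧
      ∃ c n₀, ∀ n, n₀ ≤ n → f (A.ray n) = A.ray (n + c) := fun f => by
    obtain ⟨S, hS, hfS⟩ := hpres f
    exact TreeEnds.Ascent.isEmb_of_preservesRay hA
      (TreeEnds.Ascent.ascends_of_equivalent hA hS hR₀) hfS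
  have hemb : ∀ f : TreeEnds.Emb T, A.IsEmb f := fun f => (hall f).1
  rcases hfix with ⟨v, hv⟩ | ⟨e, he, hfe⟩ | ⟨f, hf⟩
  · exact TreeEnds.Ascent.exists_preserved_of_fixed hA hemb hv
  · obtain ⟨v, rfl⟩ : ∃ v, e = s(v, A.up v) := by
      induction e with
      | _ x y =>
        rcases (hA x y).1 he with rfl | rfl
        · exact ⟨x, rfl⟩
        · exact ⟨y, Sym2.eq_swap⟩
    refine TreeEnds.Ascent.exists_preserved_of_fixed hA hemb (v := v) fun f => ?_
    have h1 := hfe f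
    rw [Sym2.map_mk, Sym2.eq_iff] at h1
    rcases h1 with ⟨h1, -⟩ | ⟨h1, h2⟩
    · exact h1
    -- A swap of the endpoints would give `up (up v) = v`, against levels.
    · rw [(hemb f).comm, h1] at h2
      have h3 := congrArg A.level h2
      rw [A.level_up, A.level_up] at h3
      omega
  · obtain ⟨c, n₀, hc⟩ := (hall f).2
    -- A zero shift would fix `ray n₀`, making `f` elliptic through a one-vertex subtree.
    have hpos : 0 < c := by
      rw [Nat.pos_iff_ne_zero]
      rintro rfl
      refine hf ⟨{A.ray n₀}, Set.finite_singleton _, Set.singleton_nonempty _, ?_, ?_⟩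
      · exact ⟨SimpleGraph.Preconnected.of_subsingleton⟩
      · rw [Set.image_singleton, hc n₀ le_rfl]; rfl
    obtain ⟨N, hN⟩ := TreeEnds.Ascent.exists_periodic_of_isRegular hA hR hRreg
      (fun g hg => (hall (hg.toEmb hA)).2) (hemb f) hpos hc
    obtain ⟨M, hM⟩ := hN.exists_preserved_tail
    refine ⟨TreeEnds.Ascent.rayFrom hA (A.ray M), fun g => ?_⟩
    rintro _ ⟨_, ⟨i, rfl⟩, rfl⟩
    obtain ⟨s, hs⟩ := hM g (hemb g)
    refine ⟨s + i, ?_⟩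
    show A.up^[s + i] (A.ray M) = g (A.up^[i] (A.ray M))
    rw [A.iterate_ray, A.iterate_ray, (hemb g).ray_add hs, add_assoc]
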